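/- \textbf{Definitions.} A morphism of schemes $h : T \to E$ is a \emph{local isomorphism} if every point of $T$ has an open neighbourhood $U$ on which $h$ restricts to an open immersion $U \to E$. A morphism $t : Y \to X$ is \emph{schematically dominant} if $\mathcal{O}_X \to t_*\mathcal{O}_Y$ is injective. For a quasi-separated morphism $f : T \to S$ with diagonal $\Delta_f : T \to T \times_S T$, the \emph{schematic closure of the diagonal} is the closed subscheme $T_1 \subset T \times_S T$ defined by the kernel of $\mathcal{O}_{T \times_S T} \to (\Delta_f)_* \mathcal{O}_T$. A \emph{separator} for a morphism $f : T \to S$ is a morphism of $S$-schemes $h : T \to E$, with $E$ separated over $S$, which is a surjective, quasi-compact and quasi-separated local isomorphism whose diagonal $\Delta_h : T \to T \times_E T$ is schematically dominant. \textbf{Proposition.} Let $S$ be an integral scheme with generic point $\eta$, and let $f : T \to S$ be a flat and quasi-separated morphism of schemes. Consider the following conditions. (i) The morphism $f$ factors as $T \xrightarrow{h} E \xrightarrow{g} S$, where $g$ is separated and $h$ is a quasi-compact local isomorphism that induces an isomorphism $T_\eta \to E_\eta$ on the fibres over $\eta$. (ii) The generic fibre $T_\eta \to \operatorname{Spec}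 \kappa(\eta)$ is separated and both composite morphisms $T_1 \to T \times_S T \rightrightarrows T$ are flat and of finite type, where $T_1$ is the schematic closure of the diagonal of $f$. Then (i) implies (ii). Conversely, if the set of irreducible components of $T$ is locally finite, then (ii) implies (i), and the factorization can be chosen such that $h$ is moreover a separator for $f$. Furthermore, for every factorization $f = g \circ h$ as in (i), $h$ is quasi-separated and its diagonal $\Delta_h$ is schematically dominant; the image $h(T)$ is open in $E$ and the induced morphism $T \to h(T)$ is a separator for $f$. In particular $h$ itself is a separator for $f$ if it is surjective. -/

import Mathlib

open CategoryTheory CategoryTheory.Limits AlgebraicGeometry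

universe u

namespace SchemeSeparator

/-- The schematic closure `T₁ ⊆ T ×[S] T` of the diagonal of `f : T ⟶ S`, i.e. the closed subscheme
defined by the kernel of `𝒪_{T ×[S] T} ⟶ (Δ_f)_* 𝒪_T` (which is quasi-coherent as soon as `f` is
quasi-separated). -/
noncomputable abbrev diagonalClosure {T S : Scheme.{u}} (f : T ⟶ S) : Scheme.{u} :=
  (pullback.diagonal f).image

/-- The composite `T₁ ⟶ T ×[S] T ⟶ T` with the first projection. -/
noncomputable def closureFst {T S : Scheme.{u}} (f : T ⟶ S) : diagonalClosure f ⟶ T :=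
  (pullback.diagonal f).imageι ≫ pullback.fst f f

/-- The composite `T₁ ⟶ T ×[S] T ⟶ T` with the second projection. -/
noncomputable def closureSnd {T S : Scheme.{u}} (f : T ⟶ S) : diagonalClosure f ⟶ T :=
  (pullback.diagonal f).imageι ≫ pullback.snd f f

/-- The morphism `T_s ⟶ E_s` on scheme-theoretic fibres over `s : S` induced by a morphism
`h : T ⟶ E` of `S`-schemes. -/
noncomputable def fiberMap {T E S : Scheme.{u}} {f : T ⟶ S} {h : T ⟶ E} {g : E ⟶ S}
    (w : h ≫ g = f) (s : S) : f.fiber s ⟶ g.fiber s :=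
  pullback.map f (S.fromSpecResidueField s) g (S.fromSpecResidueField s) h (𝟙 _) (𝟙 _)
    (by simp [w]) (by simp)

/-- `h : T ⟶ E` (with structure morphism `g : E ⟶ S`) is a separator for `f : T ⟶ S`: it is a
morphism of `S`-schemes, `E` is separated over `S`, `h` is a surjective, quasi-compact,
quasi-separated local isomorphism, and the diagonal of `h` is schematically dominant. (As `h` is
quasi-separated, its diagonal is quasi-compact, so that Mathlib's notion of schematically dominant
says that `𝒪_{T ×[E] T} ⟶ (Δ_h)_* 𝒪_T` is injective.) -/
structure IsSeparator {T E S : Scheme.{u}} (f : T ⟶ S) (h : T ⟶ E) (g : E ⟶ S) : Prop where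
  fac : h ≫ g = f
  separated : IsSeparated g
  localIso : IsLocalIso h
  surjective : Surjective h
  quasiCompact : QuasiCompact h
  quasiSeparated : QuasiSeparated h
  diagonal_dominant : IsSchemeTheoreticallyDominant (pullback.diagonal h)

/-- `T ⟶ E ⟶ S` is a factorization of `f : T ⟶ S` with `g : E ⟶ S` separated and `h : T ⟶ E` a
quasi-compact local isomorphism that induces an isomorphism `T_η ⟶ E_η` on the fibres over the
generic point `η` of the integral scheme `S`. -/
structure IsGenericIsoFactorization {T E S : Scheme.{u}} [IsIntegral S]
    (f : T ⟶ S) (h : T ⟶ E) (g : E ⟶ S) : Prop where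
  fac : h ≫ g = f
  separated : IsSeparated g
  localIso : IsLocalIso h
  quasiCompact : QuasiCompact h
  generic_iso : IsIso (fiberMap fac (genericPoint S))

/-- The generic fibre of `f : T ⟶ S` is separated and both projections to `T` of the schematic
closure of the diagonal are flat and of finite type. -/
structure HasFlatDiagonalClosure {T S : Scheme.{u}} [IsIntegral S] (f : T ⟶ S) : Prop where
  generic_separated : IsSeparated (f.fiberToSpecResidueField (genericPoint S))
  flat_fst : Flat (closureFst f)
  flat_snd : Flat (closureSnd f)
  locallyOfFiniteType_fst : LocallyOfFiniteType (closureFst f)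
  locallyOfFiniteType_snd : LocallyOfFiniteType (closureSnd f)
  quasiCompact_fst : QuasiCompact (closureFst f)
  quasiCompact_snd : QuasiCompact (closureSnd f)

end SchemeSeparator

set_option maxSynthPendingDepth 3

namespace SchemeSeparator

/-! Everything rests on schematic density. Over an integral base the generic fibre of a flat scheme
is schematically dense (`dominant_fiberι_generic`), and morphisms to a separated target that agree
on a dense part are equal (`ext_of_dominant`).

Given (i), the two projections of `T ×[E] T` agree on generic fibres, so `Δ_h` is dominant. As `g`
is separated, `T ×[E] T` is closed in `T ×[S] T`, hence equals `T₁` (`exists_iso_diagonalClosure`),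
and its projections are base changes of `h`.

Given (ii), flatness of `T₁ ⟶ T` makes `T₁` an equivalence relation (`closure_trans`), trivial on
opens separated over `S`. Between two such opens it is therefore a flat monomorphism locally of
finite type into `T`, which is an open immersion when components are locally finite
(`isOpenImmersion_of_flat_of_mono`). Gluing along these immersions gives `E`. It is separated since
`T₁` is closed in `T ×[S] T`; `h` is quasi-compact since `T₁ ⟶ T` is; `T_η ⟶ E_η` is bijective since
`T₁` is trivial over `η`. -/

instance containsIdentities_flat : MorphismProperty.ContainsIdentities @Flat.{u} :=
  (inferInstance : MorphismProperty.IsMultiplicative @Flat.{u}).toContainsIdentities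

instance containsIdentities_locallyOfFiniteType :
    MorphismProperty.ContainsIdentities @LocallyOfFiniteType.{u} :=
  (inferInstance : MorphismProperty.IsMultiplicative @LocallyOfFiniteType.{u}).toContainsIdentities

instance isZariskiLocalAtSource_flat : IsZariskiLocalAtSource @Flat.{u} :=
  HasRingHomProperty.instIsZariskiLocalAtSource (Q := RingHom.Flat)

instance isZariskiLocalAtSource_locallyOfFiniteType :
    IsZariskiLocalAtSource @LocallyOfFiniteType.{u} :=
  HasRingHomProperty.instIsZariskiLocalAtSource (Q := RingHom.FiniteType)

lemma isLocalIso_of_isPullback {X Y Z W : Scheme.{u}} {f : X ⟶ Y} {g : X ⟶ Z} {h : Y ⟶ W}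
    {k : Z ⟶ W} (sq : IsPullback f g h k) [IsLocalIso h] : IsLocalIso g :=
  (inferInstance : MorphismProperty.IsStableUnderBaseChange @IsLocalIso.{u}).of_isPullback sq ‹_›

lemma flat_of_isLocalIso {X Y : Scheme.{u}} (f : X ⟶ Y) [IsLocalIso f] : Flat f :=
  IsLocalIso.le_of_isZariskiLocalAtSource @Flat _ _ _ ‹_›

lemma locallyOfFiniteType_of_isLocalIso {X Y : Scheme.{u}} (f : X ⟶ Y) [IsLocalIso f] :
    LocallyOfFiniteType f :=
  IsLocalIso.le_of_isZariskiLocalAtSource @LocallyOfFiniteType _ _ _ ‹_›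

/-! ### Schematic dominance -/

/-- A quasi-compact morphism is schematically dominant onto its schematic image. -/
lemma isSchemeTheoreticallyDominant_toImage {X Y : Scheme.{u}} (f : X ⟶ Y) [QuasiCompact f] :
    IsSchemeTheoreticallyDominant f.toImage := by
  rw [isSchemeTheoreticallyDominant_iff]
  -- Injectivity on sections is known over preimages of affine opens of `Y`. These are affine and
  -- cover the image, which suffices to compare ideal sheaves.
  refine Scheme.IdealSheafData.ext_of_iSup_eq_top
    (fun U : Y.affineOpens ↦ ⟨f.imageι ⁻¹ᵁ U, U.2.preimage f.imageι⟩) ?_ fun U ↦ ?_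
  · exact Y.isBasis_affineOpens.isOpenCover.comap f.imageι.base.hom
  rw [Scheme.Hom.ker_apply]
  exact (RingHom.injective_iff_ker_eq_bot _).mp (f.toImage_app_injective U)

lemma dominant_of_dominant_comp {X Y Z : Scheme.{u}} (f : X ⟶ Y) (g : Y ⟶ Z)
    [IsSchemeTheoreticallyDominant (f ≫ g)] : IsSchemeTheoreticallyDominant g := by
  rw [isSchemeTheoreticallyDominant_iff, eq_bot_iff, ← (f ≫ g).ker_eq_bot]
  exact Scheme.Hom.le_ker_comp f g

lemma ker_comp_of_dominant {X Y Z : Scheme.{u}} (f : X ⟶ Y) (g : Y ⟶ Z)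
    [IsSchemeTheoreticallyDominant f] : (f ≫ g).ker = g.ker := by
  rw [Scheme.Hom.ker_comp, f.ker_eq_bot, Scheme.IdealSheafData.map_bot]

/-- A schematically dominant closed immersion is an isomorphism. -/
lemma isIso_of_isClosedImmersion_of_dominant {X Y : Scheme.{u}} (f : X ⟶ Y)
    [IsClosedImmersion f] [IsSchemeTheoreticallyDominant f] : IsIso f := by
  have h : f.ker ≤ (𝟙 Y : Y ⟶ Y).ker := by rw [f.ker_eq_bot]; exact bot_le
  refine ⟨IsClosedImmersion.lift f (𝟙 Y) h, ?_, IsClosedImmersion.lift_fac _ _ _⟩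
  rw [← cancel_mono f]
  simp

/-- Two morphisms into a separated scheme that agree on a schematically dominant morphism agree. -/
lemma ext_of_dominant {X Y Z S : Scheme.{u}} (g : Z ⟶ S) [IsSeparated g] (d : Y ⟶ X)
    [IsSchemeTheoreticallyDominant d] (a b : X ⟶ Z) (w : a ≫ g = b ≫ g) (h : d ≫ a = d ≫ b) :
    a = b := by
  -- `e` is the equalizer of `a` and `b`, closed because `g` is separated. Since `d` factors through
  -- it, `e` is also dominant, hence an isomorphism.
  let e := pullback.fst (pullback.lift a b w) (pullback.diagonal g)
  have hl : d ≫ pullback.lift a b w = (d ≫ a) ≫ pullback.diagonal g := by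
    ext <;> simp [pullback.lift_fst, pullback.lift_snd, h]
  have hd : pullback.lift d (d ≫ a) hl ≫ e = d := pullback.lift_fst _ _ _
  have : IsSchemeTheoreticallyDominant (pullback.lift d (d ≫ a) hl ≫ e) := by
    rwa [hd]
  have := dominant_of_dominant_comp (pullback.lift d (d ≫ a) hl) e
  have := isIso_of_isClosedImmersion_of_dominant e
  rw [← cancel_epi e]
  have h1 : e ≫ pullback.lift a b w = _ := pullback.condition
  have h2 := congr($h1 ≫ pullback.fst g g)
  have h3 := congr($h1 ≫ pullback.snd g g)
  simp only [Category.assoc, pullback.lift_fst, pullback.lift_snd, pullback.diagonal_fst,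
    pullback.diagonal_snd, Category.comp_id] at h2 h3
  rw [h2, h3]

/-! ### The schematic closure of the diagonal -/

section Closure

variable {T S : Scheme.{u}} (f : T ⟶ S)

lemma closureFst_comp : closureFst f ≫ f = closureSnd f ≫ f := by
  simp [closureFst, closureSnd, pullback.condition]

lemma closure_hom_ext {X : Scheme.{u}} {a b : X ⟶ diagonalClosure f}
    (h₁ : a ≫ closureFst f = b ≫ closureFst f) (h₂ : a ≫ closureSnd f = b ≫ closureSnd f) :
    a = b := by
  rw [← cancel_mono (pullback.diagonal f).imageι]
  ext
  · simpa [closureFst] using h₁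
  · simpa [closureSnd] using h₂

@[simp]
lemma toImage_closureFst : (pullback.diagonal f).toImage ≫ closureFst f = 𝟙 T := by
  simp [closureFst]

@[simp]
lemma toImage_closureSnd : (pullback.diagonal f).toImage ≫ closureSnd f = 𝟙 T := by
  simp [closureSnd]

/-- A pair of points of `T` over `S` that coincide on a schematically dominant morphism factors
through the schematic closure of the diagonal. -/
lemma exists_closure_lift {X Y : Scheme.{u}} (d : Y ⟶ X) [IsSchemeTheoreticallyDominant d]
    (a b : X ⟶ T) (w : a ≫ f = b ≫ f) (h : d ≫ a = d ≫ b) :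
    ∃ c : X ⟶ diagonalClosure f, c ≫ closureFst f = a ∧ c ≫ closureSnd f = b := by
  have hd : d ≫ pullback.lift a b w = (d ≫ a) ≫ pullback.diagonal f := by
    ext <;> simp [pullback.lift_fst, pullback.lift_snd, h]
  -- Precomposing with the dominant `d` does not change the kernel, and after it the pair factors
  -- through the diagonal.
  have hk : (pullback.diagonal f).imageι.ker ≤ (pullback.lift a b w).ker := by
    rw [← ker_comp_of_dominant d, hd, Scheme.IdealSheafData.ker_subschemeι]
    exact Scheme.Hom.le_ker_comp _ _
  refine ⟨IsClosedImmersion.lift _ _ hk, ?_, ?_⟩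
  · rw [closureFst, IsClosedImmersion.lift_fac_assoc, pullback.lift_fst]
  · rw [closureSnd, IsClosedImmersion.lift_fac_assoc, pullback.lift_snd]

end Closure

/-! ### Density of the generic fibre -/

section Generic

variable {S : Scheme.{u}} [IsIntegral S]

instance quasiCompact_fromSpecResidueField (X : Scheme.{u}) (x : X) :
    QuasiCompact (X.fromSpecResidueField x) where
  isCompact_preimage _ _ _ := (Set.toFinite _).isCompact

/-- Topological density of the generic point suffices because `S` is reduced. -/
instance dominant_generic :
    IsSchemeTheoreticallyDominant (S.fromSpecResidueField (genericPoint S)) := by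
  have : IsDominant (S.fromSpecResidueField (genericPoint S)) := by
    rw [isDominant_iff, DenseRange, Scheme.range_fromSpecResidueField, dense_iff_closure_eq]
    exact genericPoint_closure _
  exact .of_isDominant _

instance flat_fromSpecStalk (X : Scheme.{u}) (x : X) : Flat (X.fromSpecStalk x) := by
  obtain ⟨_, ⟨U, hU, rfl⟩, hx, -⟩ :=
    X.isBasis_affineOpens.exists_subset_of_mem_open (Set.mem_univ x) isOpen_univ
  rw [← hU.fromSpecStalk_eq_fromSpecStalk hx]
  have : Flat (Spec.map (X.presheaf.germ U x hx)) := by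
    rw [Flat.SpecMap_iff]
    have := hU.isLocalization_stalk ⟨x, hx⟩
    let := TopCat.Presheaf.algebra_section_stalk X.presheaf ⟨x, hx⟩
    have h : Module.Flat Γ(X, U) (X.presheaf.stalk x) :=
      IsLocalization.flat _ (hU.primeIdealOf ⟨x, hx⟩).asIdeal.primeCompl
    exact h
  have : IsOpenImmersion hU.fromSpec := hU.isOpenImmersion_fromSpec
  have : Flat (Spec.map (X.presheaf.germ U x hx) ≫ hU.fromSpec) :=
    MorphismProperty.IsStableUnderComposition.comp_mem _ _ ‹_› inferInstance
  exact this

/-- The stalk at the generic point is a field, so the residue map is an isomorphism and flatness of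
localization applies. -/
instance flat_generic : Flat (S.fromSpecResidueField (genericPoint S)) := by
  have : IsIso (S.residue (genericPoint S)) := by
    let : Field (S.presheaf.stalk (genericPoint S)) := inferInstanceAs (Field S.functionField)
    rw [ConcreteCategory.isIso_iff_bijective]
    exact ⟨RingHom.injective _, Ideal.Quotient.mk_surjective⟩
  unfold Scheme.fromSpecResidueField
  infer_instance

/-- Schematic density of the generic point is preserved by base change along the flat `p`. -/
instance dominant_fiberι_generic {P : Scheme.{u}} (p : P ⟶ S) [Flat p] :
    IsSchemeTheoreticallyDominant (p.fiberι (genericPoint S)) := by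
  exact IsSchemeTheoreticallyDominant.pullbackFst p (S.fromSpecResidueField (genericPoint S))

variable {T E : Scheme.{u}} {f : T ⟶ S} {h : T ⟶ E} {g : E ⟶ S}

@[simp]
lemma fiberMap_fiberι {T E S : Scheme.{u}} {f : T ⟶ S} {h : T ⟶ E} {g : E ⟶ S}
    (w : h ≫ g = f) (s : S) : fiberMap w s ≫ g.fiberι s = f.fiberι s ≫ h :=
  pullback.lift_fst _ _ _

@[simp]
lemma fiberMap_fiberToSpecResidueField {T E S : Scheme.{u}} {f : T ⟶ S} {h : T ⟶ E} {g : E ⟶ S}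
    (w : h ≫ g = f) (s : S) :
    fiberMap w s ≫ g.fiberToSpecResidueField s = f.fiberToSpecResidueField s :=
  (pullback.lift_snd _ _ _).trans (Category.comp_id _)

lemma fiberMap_isPullback {T E S : Scheme.{u}} {f : T ⟶ S} {h : T ⟶ E} {g : E ⟶ S}
    (w : h ≫ g = f) (s : S) : IsPullback (fiberMap w s) (f.fiberι s) (g.fiberι s) h := by
  have h1 : IsPullback (f.fiberToSpecResidueField s) (f.fiberι s) (S.fromSpecResidueField s) f :=
    (IsPullback.of_hasPullback _ _).flip
  have h2 : IsPullback (g.fiberToSpecResidueField s) (g.fiberι s) (S.fromSpecResidueField s) g :=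
    (IsPullback.of_hasPullback _ _).flip
  refine IsPullback.of_right (h₁₂ := g.fiberToSpecResidueField s)
    (h₂₂ := g) (v₁₃ := S.fromSpecResidueField s) ?_ (by simp) h2
  simpa [w] using h1

/-- If `T` is flat over the integral scheme `S` and the local isomorphism `h : T ⟶ E` over `S` is
a monomorphism on generic fibres, then the diagonal of `h` is schematically dominant. -/
lemma dominant_diagonal_of_mono_fiberMap [Flat f] (w : h ≫ g = f) [IsLocalIso h]
    [Mono (fiberMap w (genericPoint S))] :
    IsSchemeTheoreticallyDominant (pullback.diagonal h) := by
  have : IsLocalIso (pullback.fst h h) :=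
    isLocalIso_of_isPullback (IsPullback.of_hasPullback h h).flip
  have := flat_of_isLocalIso (pullback.fst h h)
  let p := pullback.fst h h ≫ f
  let η := genericPoint S
  have hp : p.fiberι η ≫ pullback.fst h h ≫ f =
      p.fiberToSpecResidueField η ≫ S.fromSpecResidueField η := pullback.condition
  have hp' : p.fiberι η ≫ pullback.snd h h ≫ f =
      p.fiberToSpecResidueField η ≫ S.fromSpecResidueField η := by
    rw [← hp, ← w, pullback.condition_assoc]
  let a : p.fiber η ⟶ f.fiber η := pullback.lift (p.fiberι η ≫ pullback.fst h h)
    (p.fiberToSpecResidueField η) (by simpa using hp)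
  let b : p.fiber η ⟶ f.fiber η := pullback.lift (p.fiberι η ≫ pullback.snd h h)
    (p.fiberToSpecResidueField η) (by simpa using hp')
  have ha : a ≫ f.fiberι η = p.fiberι η ≫ pullback.fst h h := pullback.lift_fst _ _ _
  have hb : b ≫ f.fiberι η = p.fiberι η ≫ pullback.snd h h := pullback.lift_fst _ _ _
  have ha' : a ≫ f.fiberToSpecResidueField η = p.fiberToSpecResidueField η :=
    pullback.lift_snd _ _ _
  have hb' : b ≫ f.fiberToSpecResidueField η = p.fiberToSpecResidueField η :=
    pullback.lift_snd _ _ _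
  have hab : a = b := by
    rw [← cancel_mono (fiberMap w η)]
    refine pullback.hom_ext (?_ : _ ≫ g.fiberι η = _ ≫ g.fiberι η)
      (?_ : _ ≫ g.fiberToSpecResidueField η = _ ≫ g.fiberToSpecResidueField η)
    · simp only [Category.assoc, fiberMap_fiberι]
      rw [reassoc_of% ha, reassoc_of% hb, pullback.condition]
    · simp [ha', hb']
  -- Since the projections agree there, the generic fibre of `T ×[E] T` factors through the
  -- diagonal; it is dense because `p` is flat, so the diagonal is too.
  have h1 : (p.fiberι η ≫ pullback.fst h h) ≫ pullback.diagonal h = p.fiberι η := by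
    ext
    · simp
    · simp only [Category.assoc, pullback.diagonal_snd, Category.comp_id]
      rw [← ha, hab, hb]
  have : IsSchemeTheoreticallyDominant
      ((p.fiberι η ≫ pullback.fst h h) ≫ pullback.diagonal h) := by
    rw [h1]; infer_instance
  exact dominant_of_dominant_comp (p.fiberι η ≫ pullback.fst h h) _

end Generic

/-! ### Local isomorphisms and consequences of a factorization -/

lemma isLocalIso_of_comp {X Y Z : Scheme.{u}} (f : X ⟶ Y) (g : Y ⟶ Z) [IsOpenImmersion g]
    [h : IsLocalIso (f ≫ g)] : IsLocalIso f := by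
  refine ⟨fun x ↦ ?_⟩
  obtain ⟨U, hU, hx⟩ := h.exists_isOpenImmersion x
  rw [← Category.assoc] at hx
  exact ⟨U, hU, IsOpenImmersion.of_comp _ g⟩

lemma isOpenMap_of_isLocalIso {X Y : Scheme.{u}} (f : X ⟶ Y) [h : IsLocalIso f] :
    IsOpenMap f := by
  rw [isOpenMap_iff_nhds_le]
  intro x
  obtain ⟨U, hU, hx⟩ := h.exists_isOpenImmersion x
  have h1 := (U.ι ≫ f).isOpenEmbedding.map_nhds_eq ⟨x, hU⟩
  rw [show (⇑(U.ι ≫ f) : U → Y) = f ∘ U.ι by ext; simp, ← Filter.map_map] at h1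
  refine h1.symm.le.trans ?_
  exact Filter.map_mono (U.ι.continuous.tendsto' _ _ rfl)

/-- The schematic closure of the diagonal of `h ≫ g` is `T ×[E] T` if `g` is separated and the
diagonal of `h` is schematically dominant. -/
lemma exists_iso_diagonalClosure {T E S : Scheme.{u}} (h : T ⟶ E) (g : E ⟶ S) [IsSeparated g]
    [IsSchemeTheoreticallyDominant (pullback.diagonal h)] :
    ∃ e : diagonalClosure (h ≫ g) ≅ pullback h h,
      closureFst (h ≫ g) = e.hom ≫ pullback.fst h h ∧
      closureSnd (h ≫ g) = e.hom ≫ pullback.snd h h := by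
  let m := pullback.mapDesc h h g
  have hm₁ : m ≫ pullback.fst (h ≫ g) (h ≫ g) = pullback.fst h h :=
    (pullback.lift_fst _ _ _).trans (Category.comp_id _)
  have hm₂ : m ≫ pullback.snd (h ≫ g) (h ≫ g) = pullback.snd h h :=
    (pullback.lift_snd _ _ _).trans (Category.comp_id _)
  have hm : pullback.diagonal h ≫ m = pullback.diagonal (h ≫ g) := by
    ext <;> simp [hm₁, hm₂]
  -- `m` is a closed immersion as `g` is separated, and closed immersions with equal kernels are
  -- isomorphic over the target.
  have hk : (pullback.diagonal (h ≫ g)).ker = m.ker := by rw [← hm, ker_comp_of_dominant]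
  have hk' : (pullback.diagonal (h ≫ g)).imageι.ker = m.ker := by
    rw [Scheme.IdealSheafData.ker_subschemeι, hk]
  let e : diagonalClosure (h ≫ g) ≅ pullback h h :=
    { hom := IsClosedImmersion.lift m (pullback.diagonal (h ≫ g)).imageι hk'.ge
      inv := IsClosedImmersion.lift (pullback.diagonal (h ≫ g)).imageι m hk'.le
      hom_inv_id := by rw [← cancel_mono (pullback.diagonal (h ≫ g)).imageι]; simp
      inv_hom_id := by rw [← cancel_mono m]; simp }
  have he : e.hom ≫ m = (pullback.diagonal (h ≫ g)).imageι := IsClosedImmersion.lift_fac _ _ _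
  refine ⟨e, ?_, ?_⟩
  · rw [closureFst, ← he, Category.assoc, hm₁]
  · rw [closureSnd, ← he, Category.assoc, hm₂]

section GenericIsoFactorization

variable {S : Scheme.{u}} [IsIntegral S] {T E : Scheme.{u}} {f : T ⟶ S} {h : T ⟶ E} {g : E ⟶ S}

lemma IsGenericIsoFactorization.dominant_diagonal [Flat f] (H : IsGenericIsoFactorization f h g) :
    IsSchemeTheoreticallyDominant (pullback.diagonal h) := by
  have := H.localIso
  have := H.generic_iso
  exact dominant_diagonal_of_mono_fiberMap H.fac

lemma IsGenericIsoFactorization.quasiSeparated [QuasiSeparated f]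
    (H : IsGenericIsoFactorization f h g) : QuasiSeparated h := by
  have : QuasiSeparated (h ≫ g) := by rwa [H.fac]
  exact .of_comp h g

lemma IsGenericIsoFactorization.isSeparator [Flat f] [QuasiSeparated f]
    (H : IsGenericIsoFactorization f h g) (hs : Surjective h) : IsSeparator f h g :=
  ⟨H.fac, H.separated, H.localIso, hs, H.quasiCompact, H.quasiSeparated, H.dominant_diagonal⟩

lemma IsGenericIsoFactorization.hasFlatDiagonalClosure [Flat f]
    (H : IsGenericIsoFactorization f h g) : HasFlatDiagonalClosure f := by
  have := H.dominant_diagonal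
  obtain ⟨rfl, hg, hh, hqc, hη⟩ := H
  obtain ⟨e, h₁, h₂⟩ := exists_iso_diagonalClosure h g
  have l₁ : IsLocalIso (pullback.fst h h) :=
    isLocalIso_of_isPullback (IsPullback.of_hasPullback h h).flip
  have l₂ : IsLocalIso (pullback.snd h h) :=
    isLocalIso_of_isPullback (IsPullback.of_hasPullback h h)
  have := flat_of_isLocalIso (pullback.fst h h)
  have := flat_of_isLocalIso (pullback.snd h h)
  have := locallyOfFiniteType_of_isLocalIso (pullback.fst h h)
  have := locallyOfFiniteType_of_isLocalIso (pullback.snd h h)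
  refine ⟨?_, ?_, ?_, ?_, ?_, ?_, ?_⟩
  · have : IsSeparated (g.fiberToSpecResidueField (genericPoint S)) :=
      inferInstanceAs (IsSeparated (pullback.snd _ _))
    rw [← fiberMap_fiberToSpecResidueField (rfl : h ≫ g = h ≫ g)]
    infer_instance
  all_goals first | rw [h₁] | rw [h₂]
  all_goals infer_instance

/-- Density of the diagonal only needs a monomorphism on generic fibres, a property that `h'`
inherits from `h` by cancellation. -/
lemma IsGenericIsoFactorization.exists_separator_range [Flat f] [QuasiSeparated f]
    (H : IsGenericIsoFactorization f h g) :
    ∃ (U : E.Opens) (h' : T ⟶ (U : Scheme.{u})), (U : Set E) = Set.range h ∧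
      h' ≫ U.ι = h ∧ IsSeparator f h' (U.ι ≫ g) := by
  have hqs := H.quasiSeparated
  obtain ⟨w, hg, hh, hqc, hη⟩ := H
  let U : E.Opens := ⟨Set.range h, (isOpenMap_of_isLocalIso h).isOpen_range⟩
  let h' : T ⟶ (U : Scheme.{u}) := IsOpenImmersion.lift U.ι h (by simp [U])
  have hh' : h' ≫ U.ι = h := IsOpenImmersion.lift_fac _ _ _
  have w' : h' ≫ U.ι ≫ g = f := by rw [reassoc_of% hh', w]
  have : IsLocalIso (h' ≫ U.ι) := by rwa [hh']
  have : QuasiCompact (h' ≫ U.ι) := by rwa [hh']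
  have : QuasiSeparated (h' ≫ U.ι) := by rwa [hh']
  have l' : IsLocalIso h' := isLocalIso_of_comp h' U.ι
  have hη' : fiberMap w' (genericPoint S) ≫ fiberMap (rfl : U.ι ≫ g = U.ι ≫ g) (genericPoint S) =
      fiberMap w (genericPoint S) := by
    refine pullback.hom_ext (?_ : _ ≫ g.fiberι _ = _ ≫ g.fiberι _)
      (?_ : _ ≫ g.fiberToSpecResidueField _ = _ ≫ g.fiberToSpecResidueField _)
    · have := fiberMap_fiberι w' (genericPoint S)
      rw [Category.assoc, fiberMap_fiberι, reassoc_of% this, hh', fiberMap_fiberι]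
    · simp
  have : Mono (fiberMap w' (genericPoint S)) := by
    have : Mono (fiberMap w' (genericPoint S) ≫
        fiberMap (rfl : U.ι ≫ g = U.ι ≫ g) (genericPoint S)) := by
      rw [hη']; infer_instance
    exact mono_of_mono _ (fiberMap (rfl : U.ι ≫ g = U.ι ≫ g) (genericPoint S))
  refine ⟨U, h', rfl, hh', w', inferInstance, l', ⟨fun y ↦ ?_⟩, .of_comp h' U.ι, .of_comp h' U.ι,
    dominant_diagonal_of_mono_fiberMap w'⟩
  obtain ⟨x, hx⟩ := y.2
  refine ⟨x, U.ι.injective ?_⟩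
  rw [← Scheme.Hom.comp_apply, hh']
  exact hx

end GenericIsoFactorization

/-! ### Flat monomorphisms of finite type are open immersions -/

/-- In an open subspace of a quasi-sober space with locally finite irreducible components, closed
subsets that are stable under generalization are open. -/
lemma isOpen_of_isClosed_of_stableUnderGeneralization {X Y : Type*} [TopologicalSpace X]
    [TopologicalSpace Y] [QuasiSober Y]
    (hY : LocallyFinite (fun Z : irreducibleComponents Y ↦ (Z : Set Y))) {j : X → Y}
    (hj : Topology.IsOpenEmbedding j) {Z : Set X} (hZ : IsClosed Z)
    (hg : StableUnderGeneralization Z) : IsOpen Z := by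
  rw [← isClosed_compl_iff]
  -- The complement of `Z` will be the union of the traces of the components missing `Z`, closed by
  -- local finiteness.
  let c : {C : irreducibleComponents Y // Disjoint (j ⁻¹' (C : Set Y)) Z} → Set X :=
    fun C ↦ j ⁻¹' (C.1 : Set Y)
  have hc : LocallyFinite c :=
    (hY.preimage_continuous hj.continuous).comp_injective Subtype.val_injective
  suffices h : Zᶜ = ⋃ C, c C by
    rw [h]
    exact hc.isClosed_iUnion fun C ↦
      (isClosed_of_mem_irreducibleComponents _ C.1.2).preimage hj.continuous
  refine subset_antisymm (fun x hx ↦ ?_) (Set.iUnion_subset fun C ↦ ?_)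
  · have hirr := irreducibleComponent_mem_irreducibleComponents (j x)
    have hmem : j x ∈ irreducibleComponent (j x) := mem_irreducibleComponent
    have hgen := hirr.1.isGenericPoint_genericPoint (isClosed_of_mem_irreducibleComponents _ hirr)
    obtain ⟨y, hy⟩ : hirr.1.genericPoint ∈ Set.range j :=
      (hgen.specializes hmem).mem_open hj.isOpen_range ⟨x, rfl⟩
    rw [← hy] at hgen
    have hspec {z : X} (hz : j z ∈ irreducibleComponent (j x)) : y ⤳ z :=
      hj.isInducing.specializes_iff.mp (hgen.specializes hz)
    -- If the component through `x` met `Z`, its generic point would lie in `Z` by generalization,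
    -- and then `x` would by closedness.
    refine Set.mem_iUnion.mpr ⟨⟨⟨_, hirr⟩, Set.disjoint_left.mpr fun z hz hzZ ↦ hx ?_⟩, hmem⟩
    exact (hspec hmem).mem_closed hZ (hg (hspec hz) hzZ)
  · exact Set.disjoint_left.mp C.2

section Algebra

open TensorProduct

/-- A flat surjection whose image on spectra is open is of finite presentation. -/
lemma finitePresentation_of_surjective_of_flat {A B : Type*} [CommRing A] [CommRing B] (φ : A →+* B)
    (hs : Function.Surjective φ) (hf : φ.Flat)
    (ho : IsOpen (PrimeSpectrum.zeroLocus (RingHom.ker φ : Set A))) : φ.FinitePresentation := by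
  refine .of_surjective φ hs ?_
  algebraize [φ]
  have e : (A ⧸ RingHom.ker φ) ≃ₐ[A] B :=
    Ideal.quotientKerAlgEquivOfSurjective (f := Algebra.ofId A B) hs
  -- Flatness of the quotient makes the kernel pure. Pure ideals are determined by their zero loci,
  -- and a clopen locus is cut out by an idempotent, so the kernel is principal.
  have : (RingHom.ker φ).Pure := .of_linearEquiv e.toLinearEquiv
  obtain ⟨e, he, hZ⟩ := PrimeSpectrum.isClopen_iff_zeroLocus.mp
    ⟨PrimeSpectrum.isClosed_zeroLocus _, ho⟩
  have : (Ideal.span {e}).Pure := by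
    refine .of_isIdempotentElem ⟨{e}, by simp⟩ ?_
    rw [IsIdempotentElem, Ideal.span_singleton_mul_span_singleton, he.eq]
  rw [← PrimeSpectrum.zeroLocus_span {e}] at hZ
  have hI : RingHom.ker φ = Ideal.span {e} := Ideal.zeroLocus_inj_of_pure.mp hZ
  rw [hI]
  exact ⟨{e}, by simp⟩

variable {A C : Type u} [CommRing A] [CommRing C] [Algebra A C]

/-- Locally on the source, a flat epimorphism of rings is surjective on elements. -/
lemma exists_smul_mem_range_of_flat_of_isEpi [Module.Flat A C] [Algebra.IsEpi A C]
    (q : Ideal C) [q.IsPrime] (c : C) :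
    ∃ t ∉ q.comap (algebraMap A C), t • c ∈ (algebraMap A C).range := by
  let N := LinearMap.range (Algebra.linearMap A C)
  let M := C ⧸ N
  -- For an epimorphism `x ⊗ c = xc ⊗ 1`, so the cokernel of `A → C` dies after tensoring with `C`.
  have hM (x : C) (m : M) : x ⊗ₜ[A] m = 0 := by
    obtain ⟨c, rfl⟩ := N.mkQ_surjective m
    have h1 : x ⊗ₜ[A] c = (x * c) ⊗ₜ[A] (1 : C) :=
      Algebra.IsEpi.injective_lift_mul (by simp)
    have h2 := congrArg (N.mkQ.lTensor C) h1
    rw [LinearMap.lTensor_tmul, LinearMap.lTensor_tmul] at h2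
    rw [h2, (N.mkQ_apply 1).trans ((Submodule.Quotient.mk_eq_zero N).mpr ⟨1, by simp⟩),
      TensorProduct.tmul_zero]
  let φ : A →ₗ[A] M := LinearMap.toSpanSingleton A M (N.mkQ c)
  have hmem : (1 : C) ⊗ₜ[A] (1 : A) ∈ LinearMap.ker (φ.lTensor C) := by
    rw [LinearMap.mem_ker, LinearMap.lTensor_tmul]; exact hM _ _
  -- By flatness, the annihilator of the class of `c` generates the unit ideal of `C`, so it cannot
  -- lie in the preimage of `q`.
  obtain ⟨z, hz⟩ := (Module.Flat.lTensor_exact C (LinearMap.exact_subtype_ker_map φ) _).mp hmem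
  by_contra! hcon
  have hle : LinearMap.ker φ ≤ q.comap (algebraMap A C) := fun t ht ↦ by
    by_contra htq
    refine hcon t htq ?_
    have : t • N.mkQ c = 0 := ht
    rw [← map_smul, Submodule.mkQ_apply, Submodule.Quotient.mk_eq_zero] at this
    obtain ⟨a, ha⟩ := this
    exact ⟨a, ha⟩
  have key (z : C ⊗[A] LinearMap.ker φ) :
      TensorProduct.rid A C ((LinearMap.ker φ).subtype.lTensor C z) ∈ q := by
    induction z with
    | zero => simp
    | add x y hx hy => rw [map_add, map_add]; exact q.add_mem hx hy
    | tmul x y =>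
      rw [LinearMap.lTensor_tmul, TensorProduct.rid_tmul, Algebra.smul_def]
      exact q.mul_mem_right _ (hle y.2)
  have := key z
  rw [hz, TensorProduct.rid_tmul, one_smul] at this
  exact q.ne_top_iff_one.mp ‹q.IsPrime›.ne_top this

/-- One `s` serves all of `C`: take the product of denominators of finitely many generators.
Products of elements add exponents, whence the power. -/
lemma exists_pow_smul_mem_range_of_flat_of_isEpi [Module.Flat A C] [Algebra.IsEpi A C]
    [Algebra.FiniteType A C] (q : Ideal C) [q.IsPrime] :
    ∃ s ∉ q.comap (algebraMap A C), ∀ c : C, ∃ n : ℕ, s ^ n • c ∈ (algebraMap A C).range := by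
  obtain ⟨G, hG⟩ := (‹Algebra.FiniteType A C› : Algebra.FiniteType A C).out
  choose t ht ht' using exists_smul_mem_range_of_flat_of_isEpi (A := A) q
  have hs : ∏ c ∈ G, t c ∉ q.comap (algebraMap A C) := by
    rw [Ideal.IsPrime.prod_mem_iff]
    push Not
    exact fun c _ ↦ ht c
  refine ⟨_, hs, fun c ↦ ?_⟩
  set s := ∏ c ∈ G, t c with hsd
  have hc : c ∈ Algebra.adjoin A (G : Set C) := hG ▸ Algebra.mem_top
  induction hc using Algebra.adjoin_induction with
  | mem x hx =>
    refine ⟨1, ?_⟩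
    obtain ⟨r, hr⟩ := Finset.dvd_prod_of_mem t hx
    rw [pow_one, hsd, hr, mul_comm, mul_smul, Algebra.smul_def]
    exact mul_mem ⟨r, rfl⟩ (ht' x)
  | algebraMap r => exact ⟨0, by simp⟩
  | add x y _ _ hx hy =>
    obtain ⟨n, hn⟩ := hx
    obtain ⟨m, hm⟩ := hy
    refine ⟨n + m, ?_⟩
    rw [smul_add]
    refine add_mem ?_ ?_
    · rw [add_comm, pow_add, mul_smul, Algebra.smul_def]; exact mul_mem ⟨_, rfl⟩ hn
    · rw [pow_add, mul_smul, Algebra.smul_def]; exact mul_mem ⟨_, rfl⟩ hm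
  | mul x y _ _ hx hy =>
    obtain ⟨n, hn⟩ := hx
    obtain ⟨m, hm⟩ := hy
    refine ⟨n + m, ?_⟩
    rw [pow_add, ← smul_mul_smul_comm]
    exact mul_mem hn hm

/-- A flat epimorphism of finite type is of finite presentation, if closed subsets of basic open
sets of the base that are stable under generalization are open. -/
lemma finitePresentation_of_flat_of_isEpi [Module.Flat A C] [Algebra.IsEpi A C]
    [Algebra.FiniteType A C]
    (hA : ∀ (s : A) (Z : Set (PrimeSpectrum (Localization.Away s))), IsClosed Z →
      StableUnderGeneralization Z → IsOpen Z) : (algebraMap A C).FinitePresentation := by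
  choose s hs hs' using fun q : PrimeSpectrum C ↦
    exists_pow_smul_mem_range_of_flat_of_isEpi (A := A) q.asIdeal
  refine RingHom.finitePresentation_ofLocalizationSpanTarget (algebraMap A C)
    (Set.range fun q ↦ algebraMap A C (s q)) ?_ ?_
  · by_contra h
    obtain ⟨q, hq, hle⟩ := Ideal.exists_le_maximal _ h
    exact hs ⟨q, hq.isPrime⟩ (hle (Ideal.subset_span ⟨_, rfl⟩))
  rintro ⟨_, q, rfl⟩
  let σ := s q
  have hsurj : Function.Surjective (Localization.awayMap (algebraMap A C) σ) := by
    intro y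
    obtain ⟨c, ⟨_, m, rfl⟩, rfl⟩ := IsLocalization.exists_mk'_eq
      (Submonoid.powers (algebraMap A C σ)) y
    obtain ⟨n, a, ha⟩ := hs' q c
    -- The element is `c / σ ^ m` and `σ ^ n • c` is the image of `a`, so `a / σ ^ (n + m)` maps to
    -- it.
    refine ⟨IsLocalization.mk' _ a (⟨σ ^ (n + m), n + m, rfl⟩ : Submonoid.powers σ), ?_⟩
    rw [Localization.awayMap, IsLocalization.Away.map, IsLocalization.map_mk',
      IsLocalization.mk'_eq_iff_eq]
    rw [ha, Algebra.smul_def]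
    simp only [map_pow, map_mul]
    ring
  have hflat : (Localization.awayMap (algebraMap A C) σ).Flat :=
    RingHom.Flat.propertyIsLocal.localizationAwayPreserves _ _ _ _
      (RingHom.flat_algebraMap_iff.mpr ‹_›)
  -- The zero locus of the kernel is the image on spectra: closed by surjectivity,
  -- generalization-stable by flatness.
  have hfp := finitePresentation_of_surjective_of_flat _ hsurj hflat (by
    rw [← range_comap_of_surjective _ _ hsurj]
    refine hA σ _ (PrimeSpectrum.isClosed_range_comap_of_surjective _ _ hsurj) ?_
    exact (RingHom.Flat.generalizingMap_comap hflat).stableUnderGeneralization_range)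
  have h2 : (algebraMap A (Localization.Away σ)).FinitePresentation :=
    RingHom.finitePresentation_algebraMap.mpr (IsLocalization.Away.finitePresentation σ)
  have := hfp.comp h2
  convert this using 1
  ext a
  simp [Localization.awayMap, IsLocalization.Away.map]
  rfl

end Algebra

/-- A flat monomorphism locally of finite type into a scheme with locally finite irreducible
components is an open immersion. -/
theorem isOpenImmersion_of_flat_of_mono {X Y : Scheme.{u}} (f : X ⟶ Y) [Flat f] [Mono f]
    [LocallyOfFiniteType f]
    (hY : LocallyFinite (fun Z : irreducibleComponents Y ↦ (Z : Set Y))) : IsOpenImmersion f := by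
  suffices LocallyOfFinitePresentation f from IsOpenImmersion.of_flat_of_mono f
  refine ⟨fun {U} hU {V} hV e ↦ ?_⟩
  let φ := f.appLE U V e
  have hφ : Spec.map φ ≫ hU.fromSpec = hV.fromSpec ≫ f := IsAffineOpen.SpecMap_appLE_fromSpec ..
  have := hU.isOpenImmersion_fromSpec
  have := hV.isOpenImmersion_fromSpec
  have : Mono (Spec.map φ ≫ hU.fromSpec) := by rw [hφ]; infer_instance
  have : Mono (Spec.map φ) := mono_of_mono _ hU.fromSpec
  have hepi : Epi φ := by
    refine ⟨fun a b h ↦ Spec.map_injective ?_⟩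
    rw [← cancel_mono (Spec.map φ), ← Spec.map_comp, ← Spec.map_comp, h]
  algebraize [φ.hom]
  have : Module.Flat Γ(Y, U) Γ(X, V) := f.flat_appLE hU hV e
  have : Algebra.FiniteType Γ(Y, U) Γ(X, V) := f.finiteType_appLE hU hV e
  have : Algebra.IsEpi Γ(Y, U) Γ(X, V) := CommRingCat.epi_iff_epi.mp hepi
  refine finitePresentation_of_flat_of_isEpi fun s Z hZ hg ↦ ?_
  let j : Spec (.of (Localization.Away s)) ⟶ Y :=
    Spec.map (CommRingCat.ofHom (algebraMap Γ(Y, U) (Localization.Away s))) ≫ hU.fromSpec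
  have : IsOpenImmersion j := inferInstance
  exact isOpen_of_isClosed_of_stableUnderGeneralization hY j.isOpenEmbedding hZ hg

/-! ### Quotients by gluing relations -/

/-- An equivalence relation `p, q : R ⇉ T` on a scheme, together with a covering of `T` by open
subsets on which the relation is trivial and between which it is given by open immersions. -/
structure IsGluingRelation {T R : Scheme.{u}} (p q : R ⟶ T) {I : Type u} (U : I → T.Opens) :
    Prop where
  hom_ext {X : Scheme.{u}} {a b : X ⟶ R} : a ≫ p = b ≫ p → a ≫ q = b ≫ q → a = b
  refl : ∃ d : T ⟶ R, d ≫ p = 𝟙 T ∧ d ≫ q = 𝟙 T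
  symm : ∃ s : R ⟶ R, s ≫ p = q ∧ s ≫ q = p
  trans {X : Scheme.{u}} (a b : X ⟶ R) : a ≫ q = b ≫ p →
    ∃ c : X ⟶ R, c ≫ p = a ≫ p ∧ c ≫ q = b ≫ q
  cover : TopologicalSpace.IsOpenCover U
  fst_eq_snd (i : I) : (p ⁻¹ᵁ U i ⊓ q ⁻¹ᵁ U i).ι ≫ p = (p ⁻¹ᵁ U i ⊓ q ⁻¹ᵁ U i).ι ≫ q
  openImmersion (i j : I) : IsOpenImmersion ((p ⁻¹ᵁ U i ⊓ q ⁻¹ᵁ U j).ι ≫ p)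

namespace IsGluingRelation

section Restrict

variable {T R : Scheme.{u}} (p q : R ⟶ T) {I : Type u} (U : I → T.Opens)

/-- The part of the relation between two open subsets. -/
abbrev rel (i j : I) : R.Opens := p ⁻¹ᵁ U i ⊓ q ⁻¹ᵁ U j

/-- The source of a relation between points of `U i` and `U j`. -/
noncomputable def src (i j : I) : (rel p q U i j : Scheme.{u}) ⟶ (U i : Scheme.{u}) :=
  IsOpenImmersion.lift (U i).ι ((rel p q U i j).ι ≫ p) (by
    rintro _ ⟨x, rfl⟩
    rw [Scheme.Opens.range_ι]
    exact x.2.1)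

/-- The target of a relation between points of `U i` and `U j`. -/
noncomputable def tgt (i j : I) : (rel p q U i j : Scheme.{u}) ⟶ (U j : Scheme.{u}) :=
  IsOpenImmersion.lift (U j).ι ((rel p q U i j).ι ≫ q) (by
    rintro _ ⟨x, rfl⟩
    rw [Scheme.Opens.range_ι]
    exact x.2.2)

lemma src_ι (i j : I) : src p q U i j ≫ (U i).ι = (rel p q U i j).ι ≫ p :=
  IsOpenImmersion.lift_fac _ _ _

lemma tgt_ι (i j : I) : tgt p q U i j ≫ (U j).ι = (rel p q U i j).ι ≫ q :=
  IsOpenImmersion.lift_fac _ _ _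

variable {p q U}

lemma exists_lift {i j : I} {X : Scheme.{u}} (a : X ⟶ (U i : Scheme.{u}))
    (b : X ⟶ (U j : Scheme.{u})) (c : X ⟶ R) (ha : c ≫ p = a ≫ (U i).ι)
    (hb : c ≫ q = b ≫ (U j).ι) :
    ∃ m : X ⟶ (rel p q U i j : Scheme.{u}), m ≫ (rel p q U i j).ι = c ∧
      m ≫ src p q U i j = a ∧ m ≫ tgt p q U i j = b := by
  have hr : Set.range c ⊆ Set.range (rel p q U i j).ι := by
    rintro _ ⟨x, rfl⟩
    rw [Scheme.Opens.range_ι]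
    refine ⟨?_, ?_⟩
    · change p (c x) ∈ U i
      rw [← Scheme.Hom.comp_apply, ha, Scheme.Hom.comp_apply]
      exact (a x).2
    · change q (c x) ∈ U j
      rw [← Scheme.Hom.comp_apply, hb, Scheme.Hom.comp_apply]
      exact (b x).2
  have hm := IsOpenImmersion.lift_fac (rel p q U i j).ι c hr
  refine ⟨IsOpenImmersion.lift (rel p q U i j).ι c hr, hm, ?_, ?_⟩
  · rw [← cancel_mono (U i).ι, Category.assoc, src_ι, reassoc_of% hm, ha]
  · rw [← cancel_mono (U j).ι, Category.assoc, tgt_ι, reassoc_of% hm, hb]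

end Restrict

section GlueData

variable {T R : Scheme.{u}} {p q : R ⟶ T} {I : Type u} {U : I → T.Opens}
  (H : IsGluingRelation p q U)

include H

lemma rel_hom_ext {i j : I} {X : Scheme.{u}} {a b : X ⟶ (rel p q U i j : Scheme.{u})}
    (hs : a ≫ src p q U i j = b ≫ src p q U i j) (ht : a ≫ tgt p q U i j = b ≫ tgt p q U i j) :
    a = b := by
  rw [← cancel_mono (rel p q U i j).ι]
  refine H.hom_ext ?_ ?_
  · rw [Category.assoc, Category.assoc, ← src_ι, reassoc_of% hs]
  · rw [Category.assoc, Category.assoc, ← tgt_ι, reassoc_of% ht]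

lemma isOpenImmersion_src (i j : I) : IsOpenImmersion (src p q U i j) := by
  have : IsOpenImmersion (src p q U i j ≫ (U i).ι) := by rw [src_ι]; exact H.openImmersion i j
  exact .of_comp _ (U i).ι

lemma src_eq_tgt (i : I) : src p q U i i = tgt p q U i i := by
  rw [← cancel_mono (U i).ι, src_ι, tgt_ι, H.fst_eq_snd]

lemma exists_swap (i j : I) :
    ∃ t : (rel p q U i j : Scheme.{u}) ⟶ (rel p q U j i : Scheme.{u}),
      t ≫ src p q U j i = tgt p q U i j ∧ t ≫ tgt p q U j i = src p q U i j := by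
  obtain ⟨s, hs₁, hs₂⟩ := H.symm
  obtain ⟨t, -, ht⟩ := exists_lift (tgt p q U i j) (src p q U i j) ((rel p q U i j).ι ≫ s)
    (by rw [Category.assoc, hs₁, tgt_ι]) (by rw [Category.assoc, hs₂, src_ι])
  exact ⟨t, ht⟩

/-- Exchanging source and target of a relation. -/
noncomputable def swap (i j : I) :
    (rel p q U i j : Scheme.{u}) ⟶ (rel p q U j i : Scheme.{u}) := (H.exists_swap i j).choose

lemma swap_src (i j : I) : H.swap i j ≫ src p q U j i = tgt p q U i j :=
  (H.exists_swap i j).choose_spec.1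

lemma swap_tgt (i j : I) : H.swap i j ≫ tgt p q U j i = src p q U i j :=
  (H.exists_swap i j).choose_spec.2

/-- From `x ~ y` and `x ~ z` one gets `y ~ z` by symmetry and transitivity. -/
lemma exists_compose (i j k : I) :
    ∃ m : pullback (src p q U i j) (src p q U i k) ⟶ (rel p q U j k : Scheme.{u}),
      m ≫ src p q U j k = pullback.fst _ _ ≫ tgt p q U i j ∧
      m ≫ tgt p q U j k = pullback.snd _ _ ≫ tgt p q U i k := by
  obtain ⟨c, hc₁, hc₂⟩ := H.trans
    (pullback.fst (src p q U i j) (src p q U i k) ≫ H.swap i j ≫ (rel p q U j i).ι)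
    (pullback.snd (src p q U i j) (src p q U i k) ≫ (rel p q U i k).ι) (by
      simp only [Category.assoc]
      rw [← src_ι, ← tgt_ι, reassoc_of% (H.swap_tgt i j), pullback.condition_assoc])
  obtain ⟨m, -, hm⟩ := exists_lift (pullback.fst _ _ ≫ tgt p q U i j)
    (pullback.snd _ _ ≫ tgt p q U i k) c
    (by
      rw [hc₁]
      simp only [Category.assoc]
      rw [← src_ι, reassoc_of% (H.swap_src i j)])
    (by rw [hc₂, Category.assoc, Category.assoc, ← tgt_ι])
  exact ⟨m, hm⟩

/-- The transition map on triple intersections. -/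
noncomputable def transition (i j k : I) :
    pullback (src p q U i j) (src p q U i k) ⟶ pullback (src p q U j k) (src p q U j i) :=
  pullback.lift (H.exists_compose i j k).choose (pullback.fst _ _ ≫ H.swap i j) (by
    rw [(H.exists_compose i j k).choose_spec.1, Category.assoc, H.swap_src])

lemma transition_snd (i j k : I) :
    H.transition i j k ≫ pullback.snd _ _ = pullback.fst _ _ ≫ H.swap i j :=
  pullback.lift_snd _ _ _

lemma transition_fst_src (i j k : I) :
    H.transition i j k ≫ pullback.fst _ _ ≫ src p q U j k =
      pullback.fst _ _ ≫ tgt p q U i j := by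
  rw [transition, pullback.lift_fst_assoc, (H.exists_compose i j k).choose_spec.1]

lemma transition_fst_tgt (i j k : I) :
    H.transition i j k ≫ pullback.fst _ _ ≫ tgt p q U j k =
      pullback.snd _ _ ≫ tgt p q U i k := by
  rw [transition, pullback.lift_fst_assoc, (H.exists_compose i j k).choose_spec.2]

lemma transition_snd_tgt (i j k : I) :
    H.transition i j k ≫ pullback.snd _ _ ≫ tgt p q U j i =
      pullback.fst _ _ ≫ src p q U i j := by
  rw [transition, pullback.lift_snd_assoc, Category.assoc, H.swap_tgt]

/-- The gluing data on the open cover `U` defined by the relation. -/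
noncomputable def glueData : Scheme.GlueData.{u} where
  J := I
  U i := U i
  V ij := rel p q U ij.1 ij.2
  f i j := src p q U i j
  f_open i j := H.isOpenImmersion_src i j
  f_mono i j := have := H.isOpenImmersion_src i j; inferInstance
  f_hasPullback i j k := inferInstance
  f_id i := by
    have := H.isOpenImmersion_src i i
    obtain ⟨d, hd₁, hd₂⟩ := H.refl
    obtain ⟨m, -, hm, -⟩ := exists_lift (p := p) (q := q) (𝟙 (U i : Scheme.{u})) (𝟙 _)
      ((U i).ι ≫ d) (by simp [hd₁]) (by simp [hd₂])
    exact ⟨m, by rw [← cancel_mono (src p q U i i), Category.assoc, hm]; simp, hm⟩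
  t i j := H.swap i j
  t_id i := H.rel_hom_ext (by rw [H.swap_src, ← H.src_eq_tgt, Category.id_comp])
    (by rw [H.swap_tgt, ← H.src_eq_tgt, Category.id_comp])
  t' i j k := H.transition i j k
  t_fac i j k := H.transition_snd i j k
  cocycle i j k := by
    -- On related triples the transition is the rotation `(x, y, z) ↦ (y, z, x)`; three rotations
    -- give the identity, checked on coordinates.
    have h1 : (H.transition i j k ≫ H.transition j k i ≫ H.transition k i j) ≫
        pullback.fst _ _ ≫ src p q U i j = 𝟙 _ ≫ pullback.fst _ _ ≫ src p q U i j := by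
      simp only [Category.assoc, Category.id_comp, transition_fst_src, transition_fst_tgt,
        transition_snd_tgt]
    refine pullback.hom_ext (H.rel_hom_ext (by simpa using h1) ?_)
      (H.rel_hom_ext (by simpa [pullback.condition] using h1) ?_) <;>
    simp only [Category.assoc, Category.id_comp, transition_fst_src, transition_fst_tgt,
      transition_snd_tgt]

end GlueData

section Quotient

variable {T R : Scheme.{u}} {p q : R ⟶ T} {I : Type u} {U : I → T.Opens}
  (H : IsGluingRelation p q U)

/-- The quotient of `T` by the relation. -/
noncomputable def quotient : Scheme.{u} := H.glueData.glued

/-- The open immersion of a member of the cover into the quotient. -/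
noncomputable def ι (i : I) : (U i : Scheme.{u}) ⟶ H.quotient := H.glueData.ι i

instance isOpenImmersion_ι (i : I) : IsOpenImmersion (H.ι i) :=
  H.glueData.ι_isOpenImmersion i

lemma exists_ι_eq (y : H.quotient) : ∃ (i : I) (x : (U i : Scheme.{u})), H.ι i x = y :=
  H.glueData.ι_jointly_surjective y

/-- The open cover of the quotient by the members of the cover `U`. -/
noncomputable def openCover : H.quotient.OpenCover := H.glueData.openCover

lemma src_comp_ι (i j : I) : src p q U i j ≫ H.ι i = tgt p q U i j ≫ H.ι j := by
  rw [← H.swap_src, Category.assoc]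
  exact (H.glueData.glue_condition i j).symm

/-- `src` and `tgt` exhibit the relation as the intersection of `U i` and `U j` in the quotient. -/
lemma isPullback_src_tgt (i j : I) :
    IsPullback (src p q U i j) (tgt p q U i j) (H.ι i) (H.ι j) := by
  have := IsPullback.of_isLimit (H.glueData.vPullbackConeIsLimit i j)
  refine this.of_iso (Iso.refl _) (Iso.refl _) (Iso.refl _) (Iso.refl _) ?_ ?_ ?_ ?_
  · exact (Category.comp_id _).trans (Category.id_comp _).symm
  · refine (Category.comp_id _).trans ((H.swap_src i j).trans (Category.id_comp _).symm)
  · exact (Category.comp_id _).trans (Category.id_comp _).symm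
  · exact (Category.comp_id _).trans (Category.id_comp _).symm

lemma fst_ι_eq_snd_ι (i j : I) :
    pullback.fst (U i).ι (U j).ι ≫ H.ι i = pullback.snd (U i).ι (U j).ι ≫ H.ι j := by
  obtain ⟨d, hd₁, hd₂⟩ := H.refl
  obtain ⟨m, -, hm₁, hm₂⟩ := exists_lift (p := p) (q := q)
    (pullback.fst (U i).ι (U j).ι) (pullback.snd (U i).ι (U j).ι)
    (pullback.fst (U i).ι (U j).ι ≫ (U i).ι ≫ d) (by simp [hd₁])
    (by simp [hd₂, pullback.condition])
  rw [← hm₁, ← hm₂, Category.assoc, Category.assoc, src_comp_ι]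

/-- The projection to the quotient. -/
noncomputable def proj : T ⟶ H.quotient :=
  Scheme.Cover.glueMorphisms (T.openCoverOfIsOpenCover U H.cover) H.ι H.fst_ι_eq_snd_ι

lemma ι_proj (i : I) : (U i).ι ≫ H.proj = H.ι i :=
  Scheme.Cover.ι_glueMorphisms (T.openCoverOfIsOpenCover U H.cover) H.ι _ i

instance isLocalIso_proj : IsLocalIso H.proj where
  exists_isOpenImmersion x := by
    obtain ⟨i, hi⟩ := H.cover.exists_mem x
    exact ⟨U i, hi, by rw [ι_proj]; infer_instance⟩

instance surjective_proj : Surjective H.proj where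
  surj y := by
    obtain ⟨i, x, rfl⟩ := H.exists_ι_eq y
    refine ⟨(U i).ι x, ?_⟩
    rw [← Scheme.Hom.comp_apply, ι_proj]

/-- Two charts of the quotient meet exactly in the relation between them. -/
lemma proj_eq_iff (x y : T) : H.proj x = H.proj y ↔ ∃ r : R, p r = x ∧ q r = y := by
  have hι (i : I) (z : (U i : Scheme.{u})) : H.proj ((U i).ι z) = H.ι i z := by
    rw [← Scheme.Hom.comp_apply, ι_proj]
  constructor
  · intro h
    obtain ⟨i, hi⟩ := H.cover.exists_mem x
    obtain ⟨j, hj⟩ := H.cover.exists_mem y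
    let x' : (U i : Scheme.{u}) := ⟨x, hi⟩
    let y' : (U j : Scheme.{u}) := ⟨y, hj⟩
    have hij : H.ι i x' = H.ι j y' := by
      rw [← hι, ← hι]; exact h
    obtain ⟨r, hr₁, hr₂⟩ := Scheme.exists_preimage_of_isPullback
      (H.isPullback_src_tgt i j) x' y' hij
    refine ⟨(rel p q U i j).ι r, ?_, ?_⟩
    · rw [← Scheme.Hom.comp_apply, ← src_ι, Scheme.Hom.comp_apply, hr₁]; rfl
    · rw [← Scheme.Hom.comp_apply, ← tgt_ι, Scheme.Hom.comp_apply, hr₂]; rfl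
  · rintro ⟨r, rfl, rfl⟩
    obtain ⟨i, hi⟩ := H.cover.exists_mem (p r)
    obtain ⟨j, hj⟩ := H.cover.exists_mem (q r)
    let r' : (rel p q U i j : Scheme.{u}) := ⟨r, hi, hj⟩
    have h1 : (U i).ι (src p q U i j r') = p r := by
      rw [← Scheme.Hom.comp_apply, src_ι]; rfl
    have h2 : (U j).ι (tgt p q U i j r') = q r := by
      rw [← Scheme.Hom.comp_apply, tgt_ι]; rfl
    rw [← h1, ← h2, hι, hι, ← Scheme.Hom.comp_apply, src_comp_ι, Scheme.Hom.comp_apply]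

/-- If the members of the cover are affine and the relation is quasi-compact, then so is the
projection to the quotient. -/
lemma quasiCompact_proj (hU : ∀ i, IsAffineOpen (U i)) [QuasiCompact p] :
    QuasiCompact H.proj := by
  have (i : I) : IsAffine (U i : Scheme.{u}) := hU i
  let V (i : I) : H.quotient.affineOpens := ⟨(H.ι i).opensRange, isAffineOpen_opensRange _⟩
  have hV : ⨆ i, (V i : H.quotient.Opens) = ⊤ := by
    rw [eq_top_iff]
    intro y _
    obtain ⟨i, x, rfl⟩ := H.exists_ι_eq y
    exact TopologicalSpace.Opens.mem_iSup.mpr ⟨i, ⟨x, rfl⟩⟩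
  have := @HasAffineProperty.instIsZariskiLocalAtTarget (@QuasiCompact.{u})
    (fun X _ _ _ ↦ CompactSpace X)
    instHasAffinePropertyQuasiCompactCompactSpaceCarrierCarrierCommRingCat
  refine IsZariskiLocalAtTarget.of_iSup_eq_top (P := @QuasiCompact.{u}) _ hV fun i ↦ ?_
  have : IsAffine (V i : Scheme.{u}) := (V i).2
  rw [quasiCompact_iff_compactSpace]
  -- The preimage of a chart is the saturation of `U i`, an image of the compact set `p ⁻¹' U i`.
  have hpre : ((H.proj ⁻¹ᵁ V i : T.Opens) : Set T) = q '' (p ⁻¹' U i) := by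
    ext y
    constructor
    · rintro ⟨x, hx⟩
      have : H.proj ((U i).ι x) = H.proj y := by
        rw [← Scheme.Hom.comp_apply, ι_proj]; exact hx
      obtain ⟨r, hr, hr'⟩ := (H.proj_eq_iff _ _).mp this
      refine ⟨r, ?_, hr'⟩
      change p r ∈ U i
      rw [hr]
      exact x.2
    · rintro ⟨r, hr, rfl⟩
      let x : (U i : Scheme.{u}) := ⟨p r, hr⟩
      refine ⟨x, ?_⟩
      rw [← ι_proj, Scheme.Hom.comp_apply]
      exact (H.proj_eq_iff _ _).mpr ⟨r, rfl, rfl⟩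
  have hc : IsCompact ((H.proj ⁻¹ᵁ V i : T.Opens) : Set T) := by
    rw [hpre]
    exact (p.isCompact_preimage (hU i).isCompact).image q.continuous
  exact isCompact_iff_compactSpace.mp hc

section Desc

variable {S : Scheme.{u}} (f : T ⟶ S) (w : p ≫ f = q ≫ f)

include w in
lemma desc_condition (i j : I) :
    src p q U i j ≫ (U i).ι ≫ f = (H.swap i j ≫ src p q U j i) ≫ (U j).ι ≫ f := by
  rw [swap_src, reassoc_of% (src_ι p q U i j), reassoc_of% (tgt_ι p q U i j), w]

/-- The morphism from the quotient induced by an invariant morphism. -/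
noncomputable def desc : H.quotient ⟶ S :=
  Multicoequalizer.desc _ _ (fun i ↦ (U i).ι ≫ f) fun ij ↦ H.desc_condition f w ij.1 ij.2

lemma ι_desc (i : I) : H.ι i ≫ H.desc f w = (U i).ι ≫ f :=
  Multicoequalizer.π_desc _ _ _ _ _

lemma proj_desc : H.proj ≫ H.desc f w = f := by
  have h (i : I) : (U i).ι ≫ H.proj ≫ H.desc f w = (U i).ι ≫ f := by
    rw [← ι_desc H f w, ← ι_proj, Category.assoc]
  exact (T.openCoverOfIsOpenCover U H.cover).hom_ext _ _ h

/-- The relation between `U i` and `U j` is closed in `U i ×[S] U j`. -/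
lemma isClosedImmersion_lift_src_tgt [IsClosedImmersion (pullback.lift p q w)] (i j : I)
    (a : (U i : Scheme.{u}) ⟶ S) (b : (U j : Scheme.{u}) ⟶ S) (ha : a = (U i).ι ≫ f)
    (hb : b = (U j).ι ≫ f) (w' : src p q U i j ≫ a = tgt p q U i j ≫ b) :
    IsClosedImmersion (pullback.lift (src p q U i j) (tgt p q U i j) w') := by
  subst ha hb
  have hm₁ : pullback.map ((U i).ι ≫ f) ((U j).ι ≫ f) f f (U i).ι (U j).ι (𝟙 S) (by simp)
      (by simp) ≫ pullback.fst f f = pullback.fst _ _ ≫ (U i).ι := pullback.lift_fst _ _ _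
  have hm₂ : pullback.map ((U i).ι ≫ f) ((U j).ι ≫ f) f f (U i).ι (U j).ι (𝟙 S) (by simp)
      (by simp) ≫ pullback.snd f f = pullback.snd _ _ ≫ (U j).ι := pullback.lift_snd _ _ _
  set m := pullback.map ((U i).ι ≫ f) ((U j).ι ≫ f) f f (U i).ι (U j).ι (𝟙 S) (by simp) (by simp)
  have sq : IsPullback (pullback.lift (src p q U i j) (tgt p q U i j) w') (rel p q U i j).ι m
      (pullback.lift p q w) := by
    have hl (s : PullbackCone m (pullback.lift p q w)) := exists_lift (p := p) (q := q)
      (s.fst ≫ pullback.fst _ _) (s.fst ≫ pullback.snd _ _) s.snd (by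
        have := congr($(s.condition) ≫ pullback.fst f f)
        rw [Category.assoc, Category.assoc, hm₁, pullback.lift_fst] at this
        rw [← this, Category.assoc]) (by
        have := congr($(s.condition) ≫ pullback.snd f f)
        rw [Category.assoc, Category.assoc, hm₂, pullback.lift_snd] at this
        rw [← this, Category.assoc])
    choose l hl hl₁ hl₂ using hl
    refine ⟨⟨?_⟩, ⟨PullbackCone.IsLimit.mk _ l (fun s ↦ ?_) hl ?_⟩⟩
    · refine pullback.hom_ext ?_ ?_
      · rw [Category.assoc, Category.assoc, hm₁, pullback.lift_fst_assoc, pullback.lift_fst, src_ι]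
      · rw [Category.assoc, Category.assoc, hm₂, pullback.lift_snd_assoc, pullback.lift_snd, tgt_ι]
    · refine pullback.hom_ext ?_ ?_
      · rw [Category.assoc, pullback.lift_fst, hl₁]
      · rw [Category.assoc, pullback.lift_snd, hl₂]
    · intro s m' _ h₂
      rw [← cancel_mono (rel p q U i j).ι, h₂, hl]
  exact MorphismProperty.of_isPullback (P := @IsClosedImmersion.{u}) sq.flip inferInstance

/-- Over the chart `U i ×[S] U j` the diagonal of the quotient pulls back to the relation, which is
closed there. -/
lemma isClosedImmersion_snd_diagonal_desc [IsClosedImmersion (pullback.lift p q w)] (i j : I) :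
    IsClosedImmersion (pullback.snd (pullback.diagonal (H.desc f w))
      (pullback.map (H.ι i ≫ H.desc f w) (H.ι j ≫ H.desc f w) (H.desc f w) (H.desc f w)
        (H.ι i) (H.ι j) (𝟙 S) (by simp) (by simp))) := by
  let g := H.desc f w
  have w' : src p q U i j ≫ H.ι i ≫ g = tgt p q U i j ≫ H.ι j ≫ g := by
    rw [← Category.assoc, src_comp_ι, Category.assoc]
  have hc := isClosedImmersion_lift_src_tgt f w i j (H.ι i ≫ g) (H.ι j ≫ g) (H.ι_desc f w i)
    (H.ι_desc f w j) w'
  let m : pullback (H.ι i ≫ g) (H.ι j ≫ g) ⟶ pullback g g :=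
    pullback.map _ _ _ _ (H.ι i) (H.ι j) (𝟙 S) (by simp) (by simp)
  have hm₁ : m ≫ pullback.fst g g = pullback.fst _ _ ≫ H.ι i := pullback.lift_fst _ _ _
  have hm₂ : m ≫ pullback.snd g g = pullback.snd _ _ ≫ H.ι j := pullback.lift_snd _ _ _
  have sq : IsPullback (src p q U i j ≫ H.ι i)
      (pullback.lift (src p q U i j) (tgt p q U i j) w') (pullback.diagonal g) m := by
    have hl (s : PullbackCone (pullback.diagonal g) m) : ∃ l, l ≫ src p q U i j =
        s.snd ≫ pullback.fst _ _ ∧ l ≫ tgt p q U i j = s.snd ≫ pullback.snd _ _ ∧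
        l ≫ src p q U i j ≫ H.ι i = s.fst := by
      have h₁ := congr($(s.condition) ≫ pullback.fst g g)
      have h₂ := congr($(s.condition) ≫ pullback.snd g g)
      rw [Category.assoc, Category.assoc, hm₁, pullback.diagonal_fst, Category.comp_id] at h₁
      rw [Category.assoc, Category.assoc, hm₂, pullback.diagonal_snd, Category.comp_id] at h₂
      have hw : (s.snd ≫ pullback.fst _ _) ≫ H.ι i = (s.snd ≫ pullback.snd _ _) ≫ H.ι j := by
        rw [Category.assoc, Category.assoc, ← h₁, h₂]
      refine ⟨(H.isPullback_src_tgt i j).lift _ _ hw, IsPullback.lift_fst _ _ _ _,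
        IsPullback.lift_snd _ _ _ _, ?_⟩
      rw [IsPullback.lift_fst_assoc, h₁, Category.assoc]
    choose l hl₁ hl₂ hl using hl
    refine ⟨⟨?_⟩, ⟨PullbackCone.IsLimit.mk _ l hl (fun s ↦ ?_) ?_⟩⟩
    · refine pullback.hom_ext ?_ ?_
      · simp [hm₁, pullback.lift_fst_assoc]
      · simp [hm₂, pullback.lift_snd_assoc, src_comp_ι]
    · refine pullback.hom_ext ?_ ?_
      · rw [Category.assoc, pullback.lift_fst, hl₁]
      · rw [Category.assoc, pullback.lift_snd, hl₂]
    · intro s m' _ h₂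
      refine (H.isPullback_src_tgt i j).hom_ext ?_ ?_
      · rw [hl₁, ← h₂, Category.assoc, pullback.lift_fst]
      · rw [hl₂, ← h₂, Category.assoc, pullback.lift_snd]
  change IsClosedImmersion (pullback.snd (pullback.diagonal g) m)
  rw [← sq.isoPullback_inv_snd]
  exact IsClosedImmersion.comp _ _

/-- The quotient is separated over `S` if the relation is closed in `T ×[S] T`. -/
lemma isSeparated_desc [IsClosedImmersion (pullback.lift p q w)] : IsSeparated (H.desc f w) where
  isClosedImmersion_diagonal :=
    (IsZariskiLocalAtTarget.iff_of_openCover (P := @IsClosedImmersion.{u})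
      (Scheme.Pullback.openCoverOfLeftRight H.openCover H.openCover _ _)).mpr
      fun ij ↦ H.isClosedImmersion_snd_diagonal_desc f w ij.1 ij.2

end Desc

end Quotient

end IsGluingRelation

/-! ### The quotient by the closure of the diagonal -/

/-- A bijective local isomorphism is an isomorphism. -/
lemma isIso_of_isLocalIso_of_bijective {X Y : Scheme.{u}} (f : X ⟶ Y) [h : IsLocalIso f]
    (hf : Function.Bijective f) : IsIso f := by
  have hs (x : X) : IsIso (f.stalkMap x) := by
    obtain ⟨U, hU, hx⟩ := h.exists_isOpenImmersion x
    let x' : (U : Scheme.{u}) := ⟨x, hU⟩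
    have h₁ : IsIso ((U.ι ≫ f).stalkMap x') := inferInstance
    rw [Scheme.Hom.stalkMap_comp] at h₁
    exact @IsIso.of_isIso_comp_right _ _ _ _ _ (f.stalkMap (U.ι x')) (U.ι.stalkMap x') _ h₁
  have : IsOpenImmersion f := IsOpenImmersion.iff_isIso_stalkMap.mpr
    ⟨.of_continuous_injective_isOpenMap f.continuous hf.1 (isOpenMap_of_isLocalIso f), hs⟩
  exact (isIso_iff_isOpenImmersion_and_surjective f).mpr ⟨this, ⟨hf.2⟩⟩

section

variable {T S : Scheme.{u}} (f : T ⟶ S)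

/-- The open subsets that are affine and separated over the base. -/
abbrev AffineSeparatedOpen : Type u := {U : T.Opens // IsAffineOpen U ∧ IsSeparated (U.ι ≫ f)}

lemma isOpenCover_affineSeparatedOpen :
    TopologicalSpace.IsOpenCover (fun U : AffineSeparatedOpen f ↦ U.1) := by
  refine TopologicalSpace.IsOpenCover.mk (eq_top_iff.mpr fun x _ ↦ ?_)
  obtain ⟨_, ⟨V, hV, rfl⟩, hx, -⟩ :=
    S.isBasis_affineOpens.exists_subset_of_mem_open (Set.mem_univ (f x)) isOpen_univ
  obtain ⟨_, ⟨U, hU, rfl⟩, hx', hUV⟩ :=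
    T.isBasis_affineOpens.exists_subset_of_mem_open (show x ∈ (f ⁻¹ᵁ V : T.Opens) from hx)
      (f ⁻¹ᵁ V).isOpen
  refine TopologicalSpace.Opens.mem_iSup.mpr ⟨⟨U, hU, ?_⟩, hx'⟩
  have : IsAffine (U : Scheme.{u}) := hU
  rw [← f.resLE_comp_ι hUV]
  infer_instance

instance quasiCompact_toImage_diagonal [QuasiSeparated f] :
    QuasiCompact (pullback.diagonal f).toImage :=
  have : QuasiCompact ((pullback.diagonal f).toImage ≫ (pullback.diagonal f).imageι) := by
    rw [Scheme.Hom.toImage_imageι]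
    infer_instance
  .of_comp _ (pullback.diagonal f).imageι

instance dominant_toImage_diagonal [QuasiSeparated f] :
    IsSchemeTheoreticallyDominant (pullback.diagonal f).toImage :=
  isSchemeTheoreticallyDominant_toImage _

lemma closure_refl : ∃ d : T ⟶ diagonalClosure f, d ≫ closureFst f = 𝟙 T ∧ d ≫ closureSnd f = 𝟙 T :=
  ⟨_, toImage_closureFst f, toImage_closureSnd f⟩

lemma closure_symm [QuasiSeparated f] : ∃ s : diagonalClosure f ⟶ diagonalClosure f,
    s ≫ closureFst f = closureSnd f ∧ s ≫ closureSnd f = closureFst f :=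
  exists_closure_lift f (pullback.diagonal f).toImage _ _ (closureFst_comp f).symm (by simp)

/-- It suffices to treat the outer projections of `T₁ ×[T] T₁`, which agree on the small diagonal `δ
≫ s`. This is dominant because `s` is the base change of `δ` along a projection that is flat. -/
lemma closure_trans [QuasiSeparated f] [Flat (closureFst f)] {X : Scheme.{u}}
    (a b : X ⟶ diagonalClosure f) (h : a ≫ closureSnd f = b ≫ closureFst f) :
    ∃ c : X ⟶ diagonalClosure f, c ≫ closureFst f = a ≫ closureFst f ∧
      c ≫ closureSnd f = b ≫ closureSnd f := by
  let p := closureFst f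
  let q := closureSnd f
  let δ := (pullback.diagonal f).toImage
  have hp : δ ≫ p = 𝟙 T := toImage_closureFst f
  have hq : δ ≫ q = 𝟙 T := toImage_closureSnd f
  let s : diagonalClosure f ⟶ pullback q p := pullback.lift (p ≫ δ) (𝟙 _)
    (by rw [Category.assoc, hq, Category.id_comp, Category.comp_id])
  have hs₁ : s ≫ pullback.fst q p = p ≫ δ := pullback.lift_fst _ _ _
  have hs₂ : s ≫ pullback.snd q p = 𝟙 _ := pullback.lift_snd _ _ _
  have sq : IsPullback s p (pullback.fst q p) δ := by
    refine IsPullback.of_right (h₁₂ := pullback.snd q p) (h₂₂ := q) (v₁₃ := p) ?_ hs₁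
      (IsPullback.of_hasPullback q p).flip
    rw [hs₂, hq]
    exact IsPullback.of_horiz_isIso ⟨by simp⟩
  have : Flat (pullback.fst q p) :=
    (inferInstance : MorphismProperty.IsStableUnderBaseChange @Flat.{u}).of_isPullback
      (IsPullback.of_hasPullback q p).flip ‹_›
  have : IsSchemeTheoreticallyDominant s := .of_isPullback sq.flip
  obtain ⟨c, hc₁, hc₂⟩ := exists_closure_lift f (δ ≫ s) (pullback.fst q p ≫ p)
    (pullback.snd q p ≫ q) (by
      have := closureFst_comp f
      rw [Category.assoc, Category.assoc, show p ≫ f = q ≫ f from this, pullback.condition_assoc,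
        show p ≫ f = q ≫ f from this]) (by
      rw [Category.assoc, Category.assoc, reassoc_of% hs₁, reassoc_of% hs₂, hp, hq,
        reassoc_of% hp])
  refine ⟨pullback.lift a b h ≫ c, ?_, ?_⟩
  · rw [Category.assoc, hc₁, pullback.lift_fst_assoc]
  · rw [Category.assoc, hc₂, pullback.lift_snd_assoc]

/-- The closure of the diagonal is trivial on an open subset that is separated over the base. -/
lemma closure_fst_eq_snd [QuasiSeparated f] (U : T.Opens) [IsSeparated (U.ι ≫ f)] :
    (closureFst f ⁻¹ᵁ U ⊓ closureSnd f ⁻¹ᵁ U).ι ≫ closureFst f =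
      (closureFst f ⁻¹ᵁ U ⊓ closureSnd f ⁻¹ᵁ U).ι ≫ closureSnd f := by
  let p := closureFst f
  let q := closureSnd f
  let V : PUnit.{u + 1} → T.Opens := fun _ ↦ U
  let a := IsGluingRelation.src p q V ⟨⟩ ⟨⟩
  let b := IsGluingRelation.tgt p q V ⟨⟩ ⟨⟩
  let W := IsGluingRelation.rel p q V ⟨⟩ ⟨⟩
  have ha : a ≫ U.ι = W.ι ≫ p := IsGluingRelation.src_ι p q V ⟨⟩ ⟨⟩
  have hb : b ≫ U.ι = W.ι ≫ q := IsGluingRelation.tgt_ι p q V ⟨⟩ ⟨⟩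
  let δ := (pullback.diagonal f).toImage
  have hδ : δ ≫ p = δ ≫ q := (toImage_closureFst f).trans (toImage_closureSnd f).symm
  have hab : a = b := by
    -- The diagonal stays dominant over the open `W`, and `U` is separated over `S`.
    refine ext_of_dominant (U.ι ≫ f) (pullback.snd δ W.ι) _ _ ?_ ?_
    · rw [reassoc_of% ha, reassoc_of% hb]
      exact congrArg (W.ι ≫ ·) (closureFst_comp f)
    · rw [← cancel_mono U.ι, Category.assoc, Category.assoc, ha, hb, ← pullback.condition_assoc,
        ← pullback.condition_assoc, hδ]
  exact ha.symm.trans ((congrArg (· ≫ U.ι) hab).trans hb)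

/-- If `x ~ y` and `x ~ y'` with `y`, `y'` in `V`, then `y ~ y'`, and triviality of the relation on
`V` gives `y = y'`. -/
lemma mono_closure_rel [QuasiSeparated f] [Flat (closureFst f)] (U V : T.Opens)
    [IsSeparated (V.ι ≫ f)] :
    Mono ((closureFst f ⁻¹ᵁ U ⊓ closureSnd f ⁻¹ᵁ V).ι ≫ closureFst f) := by
  let W := closureFst f ⁻¹ᵁ U ⊓ closureSnd f ⁻¹ᵁ V
  refine ⟨fun {X} (a b : X ⟶ W) (h : a ≫ W.ι ≫ closureFst f = b ≫ W.ι ≫ closureFst f) ↦ ?_⟩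
  obtain ⟨s, hs₁, hs₂⟩ := closure_symm f
  have h' : (a ≫ W.ι ≫ s) ≫ closureSnd f = (b ≫ W.ι) ≫ closureFst f := by
    simpa [hs₂] using h
  obtain ⟨c, hc₁, hc₂⟩ := closure_trans f _ _ h'
  have hW (x : W) : closureSnd f (W.ι x) ∈ V := x.2.2
  have hc : Set.range c ⊆ Set.range (closureFst f ⁻¹ᵁ V ⊓ closureSnd f ⁻¹ᵁ V).ι := by
    rintro _ ⟨x, rfl⟩
    rw [Scheme.Opens.range_ι]
    constructor
    · change closureFst f (c x) ∈ V
      rw [← Scheme.Hom.comp_apply, hc₁, Category.assoc, Category.assoc, hs₁]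
      exact hW _
    · change closureSnd f (c x) ∈ V
      rw [← Scheme.Hom.comp_apply, hc₂, Category.assoc]
      exact hW _
  have hc' : c ≫ closureFst f = c ≫ closureSnd f := by
    rw [← IsOpenImmersion.lift_fac _ c hc, Category.assoc, Category.assoc, closure_fst_eq_snd]
  rw [← cancel_mono W.ι]
  refine closure_hom_ext f (by simpa using h) ?_
  rw [← hc₂, ← hc', hc₁]
  simp [hs₁]

instance isClosedImmersion_lift_closure (w : closureFst f ≫ f = closureSnd f ≫ f) :
    IsClosedImmersion (pullback.lift (closureFst f) (closureSnd f) w) := by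
  have : pullback.lift (closureFst f) (closureSnd f) w = (pullback.diagonal f).imageι :=
    pullback.hom_ext (pullback.lift_fst _ _ _) (pullback.lift_snd _ _ _)
  rw [this]
  infer_instance

lemma isGluingRelation_closure [QuasiSeparated f] [Flat (closureFst f)]
    [LocallyOfFiniteType (closureFst f)]
    (hT : LocallyFinite (fun Z : irreducibleComponents T ↦ (Z : Set T))) :
    IsGluingRelation (closureFst f) (closureSnd f) (fun U : AffineSeparatedOpen f ↦ U.1) where
  hom_ext := closure_hom_ext f
  refl := closure_refl f
  symm := closure_symm f
  trans := closure_trans f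
  cover := isOpenCover_affineSeparatedOpen f
  fst_eq_snd U := have := U.2.2; closure_fst_eq_snd f U.1
  openImmersion U V := by
    have := V.2.2
    have := mono_closure_rel f U.1 V.1
    exact isOpenImmersion_of_flat_of_mono _ hT

variable {f} in
/-- If the generic fibre is separated, then the closure of the diagonal is trivial on it. -/
lemma closureFst_eq_closureSnd_of_generic [IsIntegral S] [QuasiSeparated f] [Flat (closureFst f)]
    [Flat f] [IsSeparated (f.fiberToSpecResidueField (genericPoint S))] (r : diagonalClosure f)
    (hr : f (closureFst f r) = genericPoint S) : closureFst f r = closureSnd f r := by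
  let η := genericPoint S
  let ρ := closureFst f ≫ f
  let δ := (pullback.diagonal f).toImage
  have wp : closureFst f ≫ f = ρ := rfl
  have wq : closureSnd f ≫ f = ρ := (closureFst_comp f).symm
  have wδ : δ ≫ ρ = f := by rw [← Category.assoc, toImage_closureFst, Category.id_comp]
  have : Flat (ρ.fiberι η) :=
    (inferInstance : MorphismProperty.IsStableUnderBaseChange @Flat.{u}).of_isPullback
      (IsPullback.of_hasPullback ρ (S.fromSpecResidueField η)).flip (flat_generic (S := S))
  -- Flat base change keeps the diagonal dominant in the generic fibre of its closure; separatedness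
  -- of `T_η` then identifies the projections.
  have : IsSchemeTheoreticallyDominant (fiberMap wδ η) :=
    .of_isPullback (fiberMap_isPullback wδ η).flip
  have h : fiberMap wp η = fiberMap wq η := by
    refine ext_of_dominant (f.fiberToSpecResidueField η) (fiberMap wδ η) _ _ (by simp) ?_
    rw [← cancel_mono (f.fiberι η)]
    simp only [Category.assoc, fiberMap_fiberι]
    rw [reassoc_of% (fiberMap_fiberι wδ η), reassoc_of% (fiberMap_fiberι wδ η),
      toImage_closureFst, toImage_closureSnd]
  obtain ⟨r', rfl⟩ : r ∈ Set.range (ρ.fiberι η) := by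
    rw [Scheme.Hom.range_fiberι]
    exact hr
  have h' := congr($h ≫ f.fiberι η)
  rw [fiberMap_fiberι, fiberMap_fiberι] at h'
  rw [← Scheme.Hom.comp_apply, h', Scheme.Hom.comp_apply]

/-- The quotient by the closure of the diagonal. -/
theorem HasFlatDiagonalClosure.exists_isGenericIsoFactorization [IsIntegral S] [Flat f]
    [QuasiSeparated f] (hT : LocallyFinite (fun Z : irreducibleComponents T ↦ (Z : Set T)))
    (hf : HasFlatDiagonalClosure f) :
    ∃ (E : Scheme.{u}) (h : T ⟶ E) (g : E ⟶ S), IsGenericIsoFactorization f h g ∧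
      Surjective h := by
  obtain ⟨_, _, _, _, _, _, _⟩ := hf
  let H := isGluingRelation_closure f hT
  have w := H.proj_desc f (closureFst_comp f)
  have hqc := H.quasiCompact_proj fun U ↦ U.2.1
  refine ⟨H.quotient, H.proj, H.desc f (closureFst_comp f),
    ⟨w, H.isSeparated_desc f _, inferInstance, hqc, ?_⟩, inferInstance⟩
  let η := genericPoint S
  have sq := fiberMap_isPullback w η
  have : IsLocalIso (fiberMap w η) := isLocalIso_of_isPullback sq.flip
  -- Points of `T_η` identified in the quotient are joined by a point of `T₁` over `η`, whose two
  -- projections coincide.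
  refine isIso_of_isLocalIso_of_bijective _ ⟨fun x y hxy ↦ ?_, ?_⟩
  · apply (f.fiberι η).isEmbedding.injective
    have hxy' : H.proj (f.fiberι η x) = H.proj (f.fiberι η y) := by
      rw [← Scheme.Hom.comp_apply, ← Scheme.Hom.comp_apply, ← fiberMap_fiberι w,
        Scheme.Hom.comp_apply, hxy, Scheme.Hom.comp_apply]
    obtain ⟨r, hr₁, hr₂⟩ := (H.proj_eq_iff _ _).mp hxy'
    rw [← hr₁, ← hr₂]
    refine closureFst_eq_closureSnd_of_generic r ?_
    rw [hr₁]
    have : f.fiberι η x ∈ Set.range (f.fiberι η) := ⟨x, rfl⟩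
    rwa [Scheme.Hom.range_fiberι] at this
  · have : Surjective (fiberMap w η) :=
      (inferInstance : MorphismProperty.IsStableUnderBaseChange @Surjective.{u}).of_isPullback
        sq.flip inferInstance
    exact this.surj

end

end SchemeSeparator

theorem mainTheorem9 {S T : Scheme.{u}} [IsIntegral S] (f : T ⟶ S) [Flat f] [QuasiSeparated f] :
    -- (i) implies (ii)
    ((∃ (E : Scheme.{u}) (h : T ⟶ E) (g : E ⟶ S),
        SchemeSeparator.IsGenericIsoFactorization f h g) →
      SchemeSeparator.HasFlatDiagonalClosure f) ∧
    -- (ii) implies (i), with a separator `h`, if the irreducible components are locally finite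
    (LocallyFinite (fun Z : irreducibleComponents T => (Z : Set T)) →
      SchemeSeparator.HasFlatDiagonalClosure f →
      ∃ (E : Scheme.{u}) (h : T ⟶ E) (g : E ⟶ S),
        SchemeSeparator.IsGenericIsoFactorization f h g ∧ SchemeSeparator.IsSeparator f h g) ∧
    -- every `h` as in (i) is a separator onto its image, which is open
    (∀ (E : Scheme.{u}) (h : T ⟶ E) (g : E ⟶ S),
      SchemeSeparator.IsGenericIsoFactorization f h g →
        QuasiSeparated h ∧ IsSchemeTheoreticallyDominant (pullback.diagonal h) ∧
        (Surjective h → SchemeSeparator.IsSeparator f h g) ∧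
        ∃ (U : E.Opens) (h' : T ⟶ (U : Scheme.{u})), (U : Set E) = Set.range h ∧
          h' ≫ U.ι = h ∧ SchemeSeparator.IsSeparator f h' (U.ι ≫ g)) := by
  refine ⟨fun ⟨E, h, g, H⟩ ↦ H.hasFlatDiagonalClosure, fun hT hf ↦ ?_, fun E h g H ↦
    ⟨H.quasiSeparated, H.dominant_diagonal, H.isSeparator, H.exists_separator_range⟩⟩
  obtain ⟨E, h, g, H, hs⟩ := hf.exists_isGenericIsoFactorization f hT
  exact ⟨E, h, g, H, H.isSeparator hs⟩
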